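/- Let $A,B$ be random variables with $\mathbb P(A\in[0,1))=1$, $\mathbb P(B\ge 0)=1$, $\mathbb P(A>0)>0$, $\mathbb P(B>0)>0$ and $\mathbb E[\max\{\log B,0\}]<\infty$ (with $\max\{\log 0,0\}=0$). Let $\rho>0$ and let $f\colon(0,\infty)\to(0,\infty)$ be a measurable function that is regularly varying at infinity of index $\rho$, i.e. $f(cx)/f(x)\to c^\rho$ as $x\to\infty$ for every $c>0$. Suppose that for every $y\ge 0$ the limit $$g(y)=\lim_{t\to\infty}\frac{-\log\mathbb P(Aty+B>t)}{f(t)}\in[0,\infty]$$ exists (with $-\log 0=\infty$), and that $g$ is admissible: either there is $\lambda>0$ with $\inf_{y>0}\{y^\rho\lambda+g(y)\}>\lambda$, or $g(0)=0$. Put $$\lambda^\ast=\inf_{y\in(0,1)}\frac{g(y)}{1-y^\rho}$$ and assume $\lambda^\ast\in(0,\infty)$. Let $\tilde f\colon(0,\infty)\to(0,\infty)$ be a continuous, strictly increasing function, regularly varying of index $\rho$, with $\tilde f(x)/f(x)\to1$ as $x\to\infty$ (one may take $\tilde f=f$ if $f$ itself is continuous and strictly increasing), and let $f^{-1}$ denote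 the inverse function of $\tilde f$, which is defined at all sufficiently large arguments. Let $(A_n,B_n)_{n\ge1}$ be independent copies of $(A,B)$, and let $X_0=0$ and $X_n=A_nX_{n-1}+B_n$ for $n\ge1$. Then, almost surely, $$\limsup_{n\to\infty}\frac{X_n}{f^{-1}(\log n)}=(\lambda^\ast)^{-1/\rho}.$$ -/

import Mathlib

open MeasureTheory ProbabilityTheory Filter Topology
open scoped NNReal ENNReal

noncomputable section

/-- `f : (0, ∞) → (0, ∞)` is measurable and regularly varying (at infinity) of index `ρ`:
`f (c x) ∼ c ^ ρ f x` as `x → ∞`, for every `c > 0`. Only the values of `f` on `(0, ∞)` matter. -/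
structure RegularlyVarying (f : ℝ → ℝ) (ρ : ℝ) : Prop where
  measurable : Measurable (Set.domRestrict (Set.Ioi (0 : ℝ)) f)
  pos : ∀ x, 0 < x → 0 < f x
  tendsto : ∀ c, 0 < c → Tendsto (fun x => f (c * x) / f x) atTop (𝓝 (c ^ ρ))

/-- `g : [0, ∞) → [0, ∞]` is the local dependence measure of the pair `(A, B)` with respect to `f`:
for every `y ≥ 0` the limit of `- log P (A t y + B > t) / f t` as `t → ∞` exists and equals `g y`.
The logarithm is extended-real valued, so `- log 0 = ∞`. -/
def IsLDM {Ω : Type*} [MeasurableSpace Ω] (P : Measure Ω) (A B : Ω → ℝ) (f : ℝ → ℝ)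
    (g : ℝ≥0 → ℝ≥0∞) : Prop :=
  ∀ y : ℝ≥0, Tendsto
    (fun t : ℝ => -ENNReal.log (P {ω | t < A ω * t * (y : ℝ) + B ω}) / ((f t : ℝ) : EReal))
    atTop (𝓝 ((g y : ℝ≥0∞) : EReal))

/-- The Legendre-type transform `φ_ρ(l) = inf_{y > 0} (y ^ ρ l + g y)`, for `l ∈ [0, ∞)`. -/
def legendreType (ρ : ℝ) (g : ℝ≥0 → ℝ≥0∞) (l : ℝ≥0) : ℝ≥0∞ :=
  ⨅ y : ℝ≥0, ⨅ _ : 0 < y, ((y : ℝ≥0∞) ^ ρ * (l : ℝ≥0∞) + g y)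

/-- `g` is admissible: `φ_ρ(l) > l` for some `l > 0`, or `g 0 = 0`. -/
def Admissible (ρ : ℝ) (g : ℝ≥0 → ℝ≥0∞) : Prop :=
  (∃ l : ℝ≥0, 0 < l ∧ (l : ℝ≥0∞) < legendreType ρ g l) ∨ g 0 = 0

/-- `λ* = inf_{y ∈ (0, 1)} g y / (1 - y ^ ρ)`, an element of `[0, ∞]`. -/
def lambdaStar (ρ : ℝ) (g : ℝ≥0 → ℝ≥0∞) : ℝ≥0∞ :=
  ⨅ y : ℝ≥0, ⨅ _ : 0 < y ∧ y < 1, g y / (1 - (y : ℝ≥0∞) ^ ρ)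

/-- The recursion `X_0 = 0`, `X_{n+1} = A_{n+1} X_n + B_{n+1}`; here `A n`, `B n` stand for
`A_{n+1}`, `B_{n+1}`, that is, the coefficient sequences are indexed from `0`. -/
def affineRec {Ω : Type*} (A B : ℕ → Ω → ℝ) : ℕ → Ω → ℝ
  | 0, _ => 0
  | n + 1, ω => A n ω * affineRec A B n ω + B n ω

/-- The inverse on `(0, ∞)` of `f`: for `u ∈ f((0, ∞))`, a point `t > 0` with `f t = u`
(the only one when `f` is strictly increasing on `(0, ∞)`); an irrelevant value otherwise. -/
def inverseOnPos (f : ℝ → ℝ) : ℝ → ℝ :=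
  Function.invFunOn f (Set.Ioi 0)

end

/-! Write `F` for the regular version of `f` and `L` for `λ*`. It is shown that `P(X_n > t)` is
roughly `exp(-L F(t))`; Borel–Cantelli at levels `c F⁻¹(log n)`, where `F` is about `c ^ ρ log n`,
then gives the threshold `L c ^ ρ = 1`.

Upper tail (`tailNegligible_univ`, `exists_tail_bound`): let `μ < L`. Reaching `t` from near `y t`
costs `μ y ^ ρ + g y` in units of `F(t)`, provided `X_n` has tail rate `μ`. For `0 < y < 1` this
exceeds `μ`, since `g y ≥ L (1 - y ^ ρ)`; for `y > 1` being at `y t` is already too expensive; near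
`y = 1` admissibility supplies the strict gap. So a bound of rate `μ` passes from `n` to `n + 1`
with the same constant.

Lower tail (`exists_tailLowerBound`): let `ν > L` and choose `y < 1` with `g y < ν (1 - y ^ ρ)`.
Climbing through levels `y ^ k t, ..., y t, t` yields costs iterating `η ↦ q η + γ`, with `q` just
above `y ^ ρ` and `γ` just above `g y`; the fixed point `γ / (1 - q)` is below `ν`. Runs restarted
from `0` on disjoint blocks are independent and lie below `X`, so the second Borel–Cantelli lemma
applies. -/

/-! ### Regular variation and logarithmic asymptotics. -/

lemma RegularlyVarying.eventually_le {F : ℝ → ℝ} {ρ c q : ℝ} (h : RegularlyVarying F ρ)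
    (hc : 0 < c) (hq : c ^ ρ < q) : ∀ᶠ x in atTop, F (c * x) ≤ q * F x := by
  filter_upwards [(h.tendsto c hc).eventually_lt_const hq, eventually_gt_atTop 0] with x hx h0
  exact ((div_lt_iff₀ (h.pos x h0)).1 hx).le

lemma RegularlyVarying.eventually_ge {F : ℝ → ℝ} {ρ c q : ℝ} (h : RegularlyVarying F ρ)
    (hc : 0 < c) (hq : q < c ^ ρ) : ∀ᶠ x in atTop, q * F x ≤ F (c * x) := by
  filter_upwards [(h.tendsto c hc).eventually_const_lt hq, eventually_gt_atTop 0] with x hx h0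
  exact ((lt_div_iff₀ (h.pos x h0)).1 hx).le

/-- Since `2 ^ ρ > 1`, doubling the argument eventually multiplies `F` by at least some `q > 1`;
monotonicity fills the gaps between the points `2 ^ n * x`. -/
lemma RegularlyVarying.tendsto_atTop {F : ℝ → ℝ} {ρ : ℝ} (h : RegularlyVarying F ρ)
    (hρ : 0 < ρ) (hF : StrictMonoOn F (Set.Ioi 0)) : Tendsto F atTop atTop := by
  have h2 : (1 : ℝ) < 2 ^ ρ := Real.one_lt_rpow (by norm_num) hρ
  obtain ⟨q, hq1, hq2⟩ := exists_between h2
  obtain ⟨T, hT⟩ := eventually_atTop.1 (h.eventually_ge two_pos hq2)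
  set x := max T 1 with hx
  have hx0 : 0 < x := lt_of_lt_of_le one_pos (le_max_right _ _)
  have key : ∀ n : ℕ, q ^ n * F x ≤ F (2 ^ n * x) := by
    intro n
    induction n with
    | zero => simp
    | succ n ih =>
      have h1 : T ≤ 2 ^ n * x := (le_max_left T 1).trans
        (le_mul_of_one_le_left hx0.le (one_le_pow₀ (by norm_num)))
      calc q ^ (n + 1) * F x = q * (q ^ n * F x) := by ring
        _ ≤ q * F (2 ^ n * x) := by gcongr
        _ ≤ F (2 * (2 ^ n * x)) := hT _ h1
        _ = _ := by ring_nf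
  refine Filter.tendsto_atTop.2 fun M => ?_
  obtain ⟨n, hn⟩ := (((tendsto_pow_atTop_atTop_of_one_lt hq1).atTop_mul_const
    (h.pos x hx0)).eventually_ge_atTop M).exists
  filter_upwards [eventually_ge_atTop (2 ^ n * x)] with y hy
  have h0 : 0 < 2 ^ n * x := by positivity
  exact hn.trans ((key n).trans (hF.monotoneOn h0 (h0.trans_le hy) hy))

lemma le_ofReal_exp_of_lt_neg_log_div {p : ℝ≥0∞} {F γ : ℝ} (hF : 0 < F)
    (h : (γ : EReal) < -ENNReal.log p / (F : EReal)) : p ≤ ENNReal.ofReal (Real.exp (-(γ * F))) := by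
  rw [EReal.lt_div_iff (by exact_mod_cast hF) (EReal.coe_ne_top _)] at h
  rw [← ENNReal.log_le_log_iff, ENNReal.log_ofReal_of_pos (Real.exp_pos _), Real.log_exp,
    EReal.coe_neg, EReal.le_neg, EReal.coe_mul]
  exact h.le

lemma ofReal_exp_le_of_neg_log_div_lt {p : ℝ≥0∞} {F γ : ℝ} (hF : 0 < F)
    (h : -ENNReal.log p / (F : EReal) < (γ : EReal)) :
    ENNReal.ofReal (Real.exp (-(γ * F))) ≤ p := by
  rw [EReal.div_lt_iff (by exact_mod_cast hF) (EReal.coe_ne_top _)] at h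
  rw [← ENNReal.log_le_log_iff, ENNReal.log_ofReal_of_pos (Real.exp_pos _), Real.log_exp,
    EReal.coe_neg, EReal.neg_le, EReal.coe_mul]
  exact h.le

lemma eventually_mul_le_mul_of_tendsto_div {F f : ℝ → ℝ} (hf : ∀ x, 0 < x → 0 < f x)
    (hFf : Tendsto (fun x => F x / f x) atTop (𝓝 1)) {a b : ℝ} (hab : a < b) :
    ∀ᶠ t in atTop, a * F t ≤ b * f t := by
  have h : Tendsto (fun x => a * (F x / f x)) atTop (𝓝 (a * 1)) := hFf.const_mul a
  filter_upwards [h.eventually_lt_const (by simpa using hab), eventually_gt_atTop 0] with t ht h0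
  rw [← mul_div_assoc, div_lt_iff₀ (hf t h0)] at ht
  exact ht.le

lemma eventually_mul_le_mul_of_tendsto_div' {F f : ℝ → ℝ} (hf : ∀ x, 0 < x → 0 < f x)
    (hFf : Tendsto (fun x => F x / f x) atTop (𝓝 1)) {a b : ℝ} (hab : a < b) :
    ∀ᶠ t in atTop, a * f t ≤ b * F t := by
  have h : Tendsto (fun x => b * (F x / f x)) atTop (𝓝 (b * 1)) := hFf.const_mul b
  filter_upwards [h.eventually_const_lt (by simpa using hab), eventually_gt_atTop 0] with t ht h0
  rw [← mul_div_assoc, lt_div_iff₀ (hf t h0)] at ht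
  exact ht.le

/-! ### Exponential bounds from the local dependence measure. -/

section LDM
variable {Ω₀ : Type*} [MeasurableSpace Ω₀] {P₀ : Measure Ω₀} [IsProbabilityMeasure P₀]
  {A B : Ω₀ → ℝ} {f F : ℝ → ℝ} {g : ℝ≥0 → ℝ≥0∞}

omit [IsProbabilityMeasure P₀] in
lemma IsLDM.eventually_le (hg : IsLDM P₀ A B f g) (hf : ∀ x, 0 < x → 0 < f x)
    (hFf : Tendsto (fun x => F x / f x) atTop (𝓝 1)) {y : ℝ≥0} {γ : ℝ}
    (h : ENNReal.ofReal γ < g y) :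
    ∀ᶠ t in atTop, P₀.real {ω | t < A ω * t * (y : ℝ) + B ω} ≤ Real.exp (-(γ * F t)) := by
  -- The gap between `γ` and `a` absorbs the replacement of `f` by `F`.
  obtain ⟨a, ha1, ha2⟩ := ENNReal.lt_iff_exists_nnreal_btwn.1 h
  have ha3 : γ < a := by
    rw [← ENNReal.ofReal_coe_nnreal] at ha1
    exact ENNReal.ofReal_lt_ofReal_iff'.1 ha1 |>.1
  have hlim := (hg y).eventually_const_lt (u := ((a : ℝ) : EReal)) (by
    have : (((a : ℝ≥0∞)) : EReal) < (g y : EReal) := by exact_mod_cast ha2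
    exact this)
  filter_upwards [hlim, eventually_mul_le_mul_of_tendsto_div hf hFf ha3,
    eventually_gt_atTop 0] with t h1 h2 h0
  have h3 := le_ofReal_exp_of_lt_neg_log_div (hf t h0) h1
  refine ENNReal.toReal_le_of_le_ofReal (Real.exp_pos _).le (h3.trans ?_)
  gcongr

lemma IsLDM.eventually_ge (hg : IsLDM P₀ A B f g) (hf : ∀ x, 0 < x → 0 < f x)
    (hFf : Tendsto (fun x => F x / f x) atTop (𝓝 1)) {y : ℝ≥0} {γ : ℝ}
    (h : g y < ENNReal.ofReal γ) :
    ∀ᶠ t in atTop, Real.exp (-(γ * F t)) ≤ P₀.real {ω | t < A ω * t * (y : ℝ) + B ω} := by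
  obtain ⟨a, ha1, ha2⟩ := ENNReal.lt_iff_exists_nnreal_btwn.1 h
  have ha3 : a < γ := by
    rw [← ENNReal.ofReal_coe_nnreal] at ha2
    exact ENNReal.ofReal_lt_ofReal_iff'.1 ha2 |>.1
  have hlim := (hg y).eventually_lt_const (u := ((a : ℝ) : EReal)) (by
    have : (g y : EReal) < (((a : ℝ≥0∞)) : EReal) := by exact_mod_cast ha1
    exact this)
  filter_upwards [hlim, eventually_mul_le_mul_of_tendsto_div' hf hFf ha3,
    eventually_gt_atTop 0] with t h1 h2 h0
  have h3 := ofReal_exp_le_of_neg_log_div_lt (hf t h0) h1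
  refine (ENNReal.ofReal_le_iff_le_toReal (measure_ne_top _ _)).1 (le_trans ?_ h3)
  gcongr

-- As `A ≥ 0`, the event only grows with `y`.
omit [IsProbabilityMeasure P₀] in
lemma IsLDM.antitone (hg : IsLDM P₀ A B f g) (hf : ∀ x, 0 < x → 0 < f x)
    (hA : ∀ᵐ ω ∂P₀, 0 ≤ A ω) : Antitone g := by
  intro y z hyz
  have h : ((g z : ℝ≥0∞) : EReal) ≤ ((g y : ℝ≥0∞) : EReal) := by
    refine le_of_tendsto_of_tendsto (hg z) (hg y) ?_
    filter_upwards [eventually_gt_atTop 0] with t ht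
    refine EReal.div_le_div_right_of_nonneg (by exact_mod_cast (hf t ht).le) ?_
    rw [EReal.neg_le_neg_iff]
    refine ENNReal.log_le_log (measure_mono_ae ?_)
    filter_upwards [hA] with ω hω hlt
    have : A ω * t * (y : ℝ) ≤ A ω * t * z :=
      mul_le_mul_of_nonneg_left (by exact_mod_cast hyz) (by positivity)
    exact lt_of_lt_of_le hlt (by linarith)
  exact_mod_cast h

end LDM

/-! ### Consequences of the definition of `λ*` and of admissibility. -/

section lambdaStar
variable {ρ : ℝ} {g : ℝ≥0 → ℝ≥0∞}

lemma one_sub_coe_rpow (hρ : 0 < ρ) (y : ℝ≥0) :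
    (1 - (y : ℝ≥0∞) ^ ρ) = ENNReal.ofReal (1 - (y : ℝ) ^ ρ) := by
  rw [ENNReal.ofReal_sub _ (by positivity), ← ENNReal.ofReal_rpow_of_nonneg y.coe_nonneg hρ.le,
    ENNReal.ofReal_coe_nnreal, ENNReal.ofReal_one]

lemma ofReal_lt_of_lt_lambdaStar (hρ : 0 < ρ) (hpos : 0 < lambdaStar ρ g) (hfin : lambdaStar ρ g < ∞) {y : ℝ≥0}
    (hy0 : 0 < y) (hy1 : y < 1) {γ : ℝ} (hγ : γ < (lambdaStar ρ g).toReal * (1 - (y : ℝ) ^ ρ)) :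
    ENNReal.ofReal γ < g y := by
  have h1 : lambdaStar ρ g ≤ g y / (1 - (y : ℝ≥0∞) ^ ρ) := iInf₂_le y ⟨hy0, hy1⟩
  have hyρ : (y : ℝ) ^ ρ < 1 := Real.rpow_lt_one y.2 (by exact_mod_cast hy1) hρ
  rw [one_sub_coe_rpow hρ] at h1
  rw [ENNReal.le_div_iff_mul_le (Or.inl (by simpa using hyρ)) (Or.inl (by simp)),
    ← ENNReal.ofReal_toReal hfin.ne, ← ENNReal.ofReal_mul (by positivity)] at h1
  have h0 : 0 < (lambdaStar ρ g).toReal * (1 - (y : ℝ) ^ ρ) :=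
    mul_pos (ENNReal.toReal_pos hpos.ne' hfin.ne) (by linarith)
  exact lt_of_lt_of_le ((ENNReal.ofReal_lt_ofReal_iff h0).2 hγ) h1

lemma exists_lt_of_lambdaStar_lt (hρ : 0 < ρ) {ν : ℝ}
    (hν : lambdaStar ρ g < ENNReal.ofReal ν) :
    ∃ y : ℝ≥0, 0 < y ∧ y < 1 ∧ ∃ γ : ℝ, 0 < γ ∧ g y < ENNReal.ofReal γ ∧
      γ < ν * (1 - (y : ℝ) ^ ρ) := by
  obtain ⟨y, hy⟩ := iInf_lt_iff.1 hν
  obtain ⟨⟨hy0, hy1⟩, h1⟩ := iInf_lt_iff.1 hy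
  have hyρ : (y : ℝ) ^ ρ < 1 := Real.rpow_lt_one y.2 (by exact_mod_cast hy1) hρ
  rw [one_sub_coe_rpow hρ] at h1
  have hν0 : 0 < ν := ENNReal.ofReal_pos.1 (lt_of_le_of_lt zero_le hν)
  rw [ENNReal.div_lt_iff (Or.inl (by simpa using hyρ)) (Or.inl (by simp)),
    ← ENNReal.ofReal_mul hν0.le] at h1
  obtain ⟨a, ha1, ha2⟩ := ENNReal.lt_iff_exists_nnreal_btwn.1 h1
  rw [← ENNReal.ofReal_coe_nnreal] at ha1 ha2
  refine ⟨y, hy0, hy1, a, ?_, ha1, (ENNReal.ofReal_lt_ofReal_iff'.1 ha2).1⟩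
  exact ENNReal.ofReal_pos.1 (lt_of_le_of_lt zero_le ha1)

/-- If `g` vanished on `(1, ∞)`, letting `r ↓ 1` would give `φ_ρ(l) ≤ l`. If `g 0 = 0`, monotonicity
gives `g (1 / 2) = 0` and hence `λ* = 0`. -/
lemma Admissible.exists_one_lt_pos (hadm : Admissible ρ g) (hg : Antitone g)
    (hpos : 0 < lambdaStar ρ g) : ∃ r : ℝ≥0, 1 < r ∧ 0 < g r := by
  rcases hadm with ⟨l, hl0, hl⟩ | h0
  · by_contra! hcon
    have hle : ∀ r : ℝ≥0, 1 < r → legendreType ρ g l ≤ ((r ^ ρ * l : ℝ≥0) : ℝ≥0∞) := by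
      intro r hr
      have hr0 : 0 < r := one_pos.trans hr
      refine (iInf₂_le r hr0).trans ?_
      rw [nonpos_iff_eq_zero.1 (hcon r hr), add_zero, ENNReal.coe_mul,
        ENNReal.coe_rpow_of_ne_zero hr0.ne']
    have hlim : Tendsto (fun r : ℝ≥0 => ((r ^ ρ * l : ℝ≥0) : ℝ≥0∞)) (𝓝[>] 1)
        (𝓝 ((1 ^ ρ * l : ℝ≥0) : ℝ≥0∞)) := by
      refine ENNReal.tendsto_coe.2 (Tendsto.mono_left ?_ nhdsWithin_le_nhds)
      exact ((NNReal.continuousAt_rpow_const (Or.inl one_ne_zero)).tendsto).mul_const l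
    have := ge_of_tendsto hlim (eventually_nhdsWithin_of_forall hle)
    rw [NNReal.one_rpow, one_mul] at this
    exact absurd hl this.not_gt
  · exfalso
    have hy : g (1 / 2) = 0 := nonpos_iff_eq_zero.1 (h0 ▸ hg zero_le)
    have h1 : lambdaStar ρ g ≤ g (1 / 2) / (1 - ((1 / 2 : ℝ≥0) : ℝ≥0∞) ^ ρ) :=
      iInf₂_le (1 / 2 : ℝ≥0) ⟨by norm_num, by
        rw [div_lt_one two_pos]; exact one_lt_two⟩
    rw [hy, ENNReal.zero_div] at h1
    exact absurd hpos h1.not_gt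

end lambdaStar

/-! ### The affine recursion and its independence structure. -/

lemma measurable_affineRec {Ω : Type*} {m : MeasurableSpace Ω} {As Bs : ℕ → Ω → ℝ} {n : ℕ}
    (hA : ∀ i < n, Measurable (As i)) (hB : ∀ i < n, Measurable (Bs i)) :
    Measurable (affineRec As Bs n) := by
  induction n with
  | zero => exact measurable_const
  | succ n ih =>
    exact ((hA n n.lt_succ_self).mul (ih (fun i hi => hA i (hi.trans n.lt_succ_self))
      (fun i hi => hB i (hi.trans n.lt_succ_self)))).add (hB n n.lt_succ_self)

lemma affineRec_nonneg {Ω : Type*} {As Bs : ℕ → Ω → ℝ} {ω : Ω} (hA : ∀ i, 0 ≤ As i ω)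
    (hB : ∀ i, 0 ≤ Bs i ω) (n : ℕ) : 0 ≤ affineRec As Bs n ω := by
  induction n with
  | zero => exact le_rfl
  | succ n ih => exact add_nonneg (mul_nonneg (hA n) ih) (hB n)

/-- Restarting from `0` at time `m` discards a nonnegative state, and the recursion is monotone in
its state. -/
lemma affineRec_shift_le {Ω : Type*} {As Bs : ℕ → Ω → ℝ} {ω : Ω} (hA : ∀ i, 0 ≤ As i ω)
    (hB : ∀ i, 0 ≤ Bs i ω) (m k : ℕ) :
    affineRec (fun i => As (m + i)) (fun i => Bs (m + i)) k ω ≤ affineRec As Bs (m + k) ω := by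
  induction k with
  | zero => exact affineRec_nonneg hA hB _
  | succ k ih => exact add_le_add_left (mul_le_mul_of_nonneg_left ih (hA _)) _

/-- `(As n, Bs n)` are independent copies of the nonnegative pair `(A, B)`. -/
structure IsIIDCopies {Ω₀ Ω : Type*} [MeasurableSpace Ω₀] [MeasurableSpace Ω] (P₀ : Measure Ω₀)
    (P : Measure Ω) (A B : Ω₀ → ℝ) (As Bs : ℕ → Ω → ℝ) : Prop where
  measurable_fst : ∀ n, Measurable (As n)
  measurable_snd : ∀ n, Measurable (Bs n)
  indep : iIndepFun (fun n ω => (As n ω, Bs n ω)) P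
  ident : ∀ n, IdentDistrib (fun ω => (As n ω, Bs n ω)) (fun ω => (A ω, B ω)) P P₀
  nonneg : ∀ᵐ ω ∂P₀, 0 ≤ A ω ∧ 0 ≤ B ω

namespace IsIIDCopies
variable {Ω₀ Ω : Type*} [MeasurableSpace Ω₀] [MeasurableSpace Ω] {P₀ : Measure Ω₀}
    {P : Measure Ω} {A B : Ω₀ → ℝ} {As Bs : ℕ → Ω → ℝ}

lemma shift (h : IsIIDCopies P₀ P A B As Bs) (m : ℕ) :
    IsIIDCopies P₀ P A B (fun i => As (m + i)) (fun i => Bs (m + i)) where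
  measurable_fst _ := h.measurable_fst _
  measurable_snd _ := h.measurable_snd _
  indep := h.indep.precomp (g := fun i => m + i) (add_right_injective m)
  ident _ := h.ident _
  nonneg := h.nonneg

lemma ae_nonneg (h : IsIIDCopies P₀ P A B As Bs) :
    ∀ᵐ ω ∂P, (∀ i, 0 ≤ As i ω) ∧ (∀ i, 0 ≤ Bs i ω) := by
  have : ∀ i, ∀ᵐ ω ∂P, 0 ≤ As i ω ∧ 0 ≤ Bs i ω := fun i =>
    (h.ident i).symm.ae_snd (p := fun z : ℝ × ℝ => 0 ≤ z.1 ∧ 0 ≤ z.2)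
      ((measurableSet_le measurable_const _root_.measurable_fst).inter
        (measurableSet_le measurable_const _root_.measurable_snd)) h.nonneg
  filter_upwards [ae_all_iff.2 this] with ω hω
  exact ⟨fun i => (hω i).1, fun i => (hω i).2⟩

lemma measurable_rec (h : IsIIDCopies P₀ P A B As Bs) (n : ℕ) : Measurable (affineRec As Bs n) :=
  measurable_affineRec (fun i _ => h.measurable_fst i) (fun i _ => h.measurable_snd i)

lemma comap_le (h : IsIIDCopies P₀ P A B As Bs) (i : ℕ) :
    MeasurableSpace.comap (fun ω => (As i ω, Bs i ω)) inferInstance ≤ ‹MeasurableSpace Ω› :=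
  ((h.measurable_fst i).prodMk (h.measurable_snd i)).comap_le

/-- The events depending on the coefficients with index in `S`. -/
abbrev sigma (As Bs : ℕ → Ω → ℝ) (S : Set ℕ) : MeasurableSpace Ω :=
  ⨆ i ∈ S, MeasurableSpace.comap (fun ω => (As i ω, Bs i ω)) inferInstance

omit [MeasurableSpace Ω] in
lemma measurable_rec_sigma (m k : ℕ) {S : Set ℕ} (hS : ∀ i < k, m + i ∈ S) :
    Measurable[sigma As Bs S]
      (affineRec (fun i => As (m + i)) (fun i => Bs (m + i)) k) := by
  have h : ∀ i < k, Measurable[sigma As Bs S] (fun ω => (As (m + i) ω, Bs (m + i) ω)) := by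
    intro i hi
    exact (comap_measurable _).mono (le_iSup₂_of_le (m + i) (hS i hi) le_rfl) le_rfl
  exact measurable_affineRec (fun i hi => _root_.measurable_fst.comp (h i hi))
    (fun i hi => _root_.measurable_snd.comp (h i hi))

lemma indep_sigma (h : IsIIDCopies P₀ P A B As Bs) {S T : Set ℕ} (hST : Disjoint S T) :
    Indep (sigma As Bs S) (sigma As Bs T) P :=
  indep_iSup_of_disjoint h.comap_le h.indep.iIndep hST

/-- The state at time `n` uses only coefficients of index below `n`, hence is independent of the
pair of index `n`. -/
lemma measureReal_rec_inter (h : IsIIDCopies P₀ P A B As Bs) (n : ℕ) (s t y : ℝ) :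
    P.real {ω | s < affineRec As Bs n ω ∧ t < As n ω * t * y + Bs n ω}
      = P.real {ω | s < affineRec As Bs n ω} * P₀.real {ω | t < A ω * t * y + B ω} := by
  have hφ : Measurable (fun z : ℝ × ℝ => z.1 * t * y + z.2) := by fun_prop
  have hD : MeasurableSet {z : ℝ × ℝ | t < z.1 * t * y + z.2} :=
    measurableSet_lt measurable_const hφ
  have hind := h.indep_sigma (S := Set.Iio n) (T := {n}) (by simp)
  have h1 : MeasurableSet[sigma As Bs (Set.Iio n)] {ω | s < affineRec As Bs n ω} := by
    have := measurable_rec_sigma (As := As) (Bs := Bs) 0 n (S := Set.Iio n) (by simp)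
    simp only [zero_add] at this
    exact this measurableSet_Ioi
  have h2 : MeasurableSet[sigma As Bs {n}] {ω | t < As n ω * t * y + Bs n ω} := by
    have : Measurable[sigma As Bs {n}] (fun ω => (As n ω, Bs n ω)) :=
      (comap_measurable _).mono (le_iSup₂_of_le n rfl le_rfl) le_rfl
    exact this hD
  have h3 := (h.ident n).measure_mem_eq hD
  have h4 := (Indep_iff _ _ _).1 hind _ _ h1 h2
  change P {ω | t < As n ω * t * y + Bs n ω} = P₀ {ω | t < A ω * t * y + B ω} at h3
  change (P ({ω | s < affineRec As Bs n ω} ∩ {ω | t < As n ω * t * y + Bs n ω})).toReal = _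
  rw [h4, ENNReal.toReal_mul, h3]
  rfl

lemma iIndepSet_blocks (h : IsIIDCopies P₀ P A B As Bs) (k : ℕ) (t : ℕ → ℝ) :
    iIndepSet (fun j => {ω | t j <
      affineRec (fun i => As (j * k + i)) (fun i => Bs (j * k + i)) k ω}) P := by
  have := h.indep.isProbabilityMeasure
  have hE : ∀ j, MeasurableSet[sigma As Bs (Set.Ico (j * k) (j * k + k))] {ω | t j <
      affineRec (fun i => As (j * k + i)) (fun i => Bs (j * k + i)) k ω} := fun j =>
    measurable_rec_sigma (j * k) k (by simp) measurableSet_Ioi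
  have hle : ∀ S, sigma As Bs S ≤ ‹MeasurableSpace Ω› := fun S =>
    iSup₂_le fun i _ => h.comap_le i
  rw [iIndepSet_iff_meas_biInter (fun j => hle _ _ (hE j))]
  intro s
  induction s using Finset.induction_on with
  | empty => simp
  | insert a s ha ih =>
    rw [Finset.prod_insert ha, Finset.set_biInter_insert, ← ih]
    refine (Indep_iff _ _ _).1 (h.indep_sigma (S := Set.Ico (a * k) (a * k + k))
      (T := ⋃ j ∈ s, Set.Ico (j * k) (j * k + k)) ?_) _ _ (hE a) ?_
    · simp only [Set.disjoint_iUnion_right]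
      intro j hj
      have hja : j ≠ a := fun e => ha (e ▸ hj)
      rw [Set.disjoint_left]
      rintro x ⟨hx1, hx2⟩ ⟨hx3, hx4⟩
      rcases lt_or_gt_of_ne hja with hlt | hlt
      · have := Nat.mul_le_mul_right k (Nat.succ_le_of_lt hlt)
        rw [Nat.succ_mul] at this; omega
      · have := Nat.mul_le_mul_right k (Nat.succ_le_of_lt hlt)
        rw [Nat.succ_mul] at this; omega
    · refine s.measurableSet_biInter fun j hj => ?_
      have hsub : Set.Ico (j * k) (j * k + k) ⊆ ⋃ j ∈ s, Set.Ico (j * k) (j * k + k) :=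
        Set.subset_biUnion_of_mem (u := fun j => Set.Ico (j * k) (j * k + k)) hj
      exact biSup_mono (f := fun i => MeasurableSpace.comap (fun ω => (As i ω, Bs i ω))
        inferInstance) hsub _ (hE j)

end IsIIDCopies

/-! ### Upper tail bound, uniform in `n`. -/

/-- Jumps over a high level `t` from a state in `t • S` preserve, with an arbitrarily small factor,
exponential tail bounds of rate `μ` on the scale `F`. -/
def TailNegligible {Ω : Type*} [MeasurableSpace Ω] (P : Measure Ω) (As Bs : ℕ → Ω → ℝ)
    (F : ℝ → ℝ) (μ : ℝ) (S : Set ℝ) : Prop :=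
  ∀ κ > 0, ∀ᶠ t in atTop, ∀ C ≥ 1, ∀ n,
    (∀ s > 0, P.real {ω | s < affineRec As Bs n ω} ≤ C * Real.exp (-(μ * F s))) →
    P.real {ω | affineRec As Bs n ω / t ∈ S ∧ t < affineRec As Bs (n + 1) ω}
      ≤ κ * (C * Real.exp (-(μ * F t)))

section
variable {Ω₀ Ω : Type*} [MeasurableSpace Ω₀] [MeasurableSpace Ω] {P₀ : Measure Ω₀}
  {P : Measure Ω} [IsProbabilityMeasure P]
  {A B : Ω₀ → ℝ} {As Bs : ℕ → Ω → ℝ} {f F : ℝ → ℝ} {μ ρ : ℝ} {g : ℝ≥0 → ℝ≥0∞}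

lemma TailNegligible.mono {S T : Set ℝ} (hST : S ⊆ T) (h : TailNegligible P As Bs F μ T) :
    TailNegligible P As Bs F μ S := by
  intro κ hκ
  filter_upwards [h κ hκ] with t ht C hC n hn
  exact (measureReal_mono (s₂ := {ω | affineRec As Bs n ω / t ∈ T ∧ t < affineRec As Bs (n + 1) ω})
    fun ω hω => ⟨hST hω.1, hω.2⟩).trans (ht C hC n hn)

-- The arbitrary factor `κ` in the definition is what makes finite unions harmless.
omit [IsProbabilityMeasure P] in
lemma TailNegligible.union {S T : Set ℝ} (hS : TailNegligible P As Bs F μ S)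
    (hT : TailNegligible P As Bs F μ T) : TailNegligible P As Bs F μ (S ∪ T) := by
  intro κ hκ
  filter_upwards [hS (κ / 2) (half_pos hκ), hT (κ / 2) (half_pos hκ)] with t h1 h2 C hC n hn
  calc _ = P.real ({ω | affineRec As Bs n ω / t ∈ S ∧ t < affineRec As Bs (n + 1) ω} ∪
        {ω | affineRec As Bs n ω / t ∈ T ∧ t < affineRec As Bs (n + 1) ω}) := by
        congr 1; ext ω; simp only [Set.mem_union, Set.mem_ofPred_eq, or_and_right]
    _ ≤ _ := measureReal_union_le _ _
    _ ≤ _ := add_le_add (h1 C hC n hn) (h2 C hC n hn)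
    _ = _ := by ring

omit [IsProbabilityMeasure P] in
lemma TailNegligible.empty : TailNegligible P As Bs F μ ∅ := by
  intro κ hκ
  refine Eventually.of_forall fun t C hC n _ => ?_
  have : (0 : ℝ) ≤ C := zero_le_one.trans hC
  simp only [Set.mem_empty_iff_false, false_and, Set.ofPred_false, measureReal_empty]
  positivity

lemma tendsto_exp_neg_mul (hF : Tendsto F atTop atTop) {e : ℝ} (he : 0 < e) :
    Tendsto (fun t => Real.exp (-(e * F t))) atTop (𝓝 0) :=
  Real.tendsto_exp_neg_atTop_nhds_zero.comp (hF.const_mul_atTop he)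

/-- The state must exceed `l t`, at cost `μ l ^ ρ`, and the jump is at most as hard as from `r t`,
at cost more than `γ`; the total beats `μ`. -/
lemma tailNegligible_Ioc (h : IsIIDCopies P₀ P A B As Bs) (hg : IsLDM P₀ A B f g)
    (hf : ∀ x, 0 < x → 0 < f x) (hFf : Tendsto (fun x => F x / f x) atTop (𝓝 1))
    (hF : RegularlyVarying F ρ) (hFt : Tendsto F atTop atTop) (hμ : 0 < μ) {l γ : ℝ} {r : ℝ≥0}
    (hl : 0 < l) (hγ : ENNReal.ofReal γ < g r) (hlγ : μ < μ * l ^ ρ + γ) :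
    TailNegligible P As Bs F μ (Set.Ioc l r) := by
  intro κ hκ
  obtain ⟨q, hq1, hq2⟩ : ∃ q, (μ - γ) / μ < q ∧ q < l ^ ρ :=
    exists_between (by rw [div_lt_iff₀ hμ]; linarith)
  rw [div_lt_iff₀ hμ] at hq1
  filter_upwards [hg.eventually_le hf hFf hγ, hF.eventually_ge hl hq2, eventually_gt_atTop 0,
    (tendsto_exp_neg_mul hFt (e := q * μ + γ - μ) (by linarith)).eventually_le_const hκ]
    with t h1 h2 h0 h3 C hC n hn
  have hC0 : (0 : ℝ) ≤ C := zero_le_one.trans hC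
  calc _ ≤ P.real {ω | l * t < affineRec As Bs n ω ∧ t < As n ω * t * r + Bs n ω} := by
        refine ENNReal.toReal_mono (measure_ne_top _ _) (measure_mono_ae ?_)
        filter_upwards [h.ae_nonneg] with ω hω ⟨⟨ha, hb⟩, hc⟩
        rw [lt_div_iff₀ h0] at ha
        rw [div_le_iff₀ h0] at hb
        refine ⟨ha, hc.trans_le ?_⟩
        have := mul_le_mul_of_nonneg_left hb (hω.1 n)
        change As n ω * affineRec As Bs n ω + Bs n ω ≤ _
        linarith
    _ = P.real {ω | l * t < affineRec As Bs n ω} * P₀.real {ω | t < A ω * t * r + B ω} :=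
        h.measureReal_rec_inter n _ _ _
    _ ≤ (C * Real.exp (-(μ * F (l * t)))) * Real.exp (-(γ * F t)) := by
        gcongr
        exact hn _ (by positivity)
    _ ≤ (C * Real.exp (-(μ * (q * F t)))) * Real.exp (-(γ * F t)) := by gcongr
    _ = Real.exp (-((q * μ + γ - μ) * F t)) * (C * Real.exp (-(μ * F t))) := by
        rw [mul_assoc, ← Real.exp_add, mul_left_comm (Real.exp _), ← Real.exp_add]
        ring_nf
    _ ≤ _ := by gcongr

/-- Near `0` the jump alone costs more than `μ`, so the law of the state plays no role. -/
lemma tailNegligible_Iic (h : IsIIDCopies P₀ P A B As Bs) (hg : IsLDM P₀ A B f g)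
    (hf : ∀ x, 0 < x → 0 < f x) (hFf : Tendsto (fun x => F x / f x) atTop (𝓝 1))
    (hFt : Tendsto F atTop atTop) {γ : ℝ} {r : ℝ≥0}
    (hγ : ENNReal.ofReal γ < g r) (hμγ : μ < γ) :
    TailNegligible P As Bs F μ (Set.Iic r) := by
  intro κ hκ
  filter_upwards [hg.eventually_le hf hFf hγ, eventually_gt_atTop 0,
    (tendsto_exp_neg_mul hFt (e := γ - μ) (by linarith)).eventually_le_const hκ]
    with t h1 h0 h3 C hC n hn
  have hC0 : (0 : ℝ) ≤ C := zero_le_one.trans hC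
  -- The threshold `-1` makes the first event almost sure, so that the product formula still
  -- applies.
  calc _ ≤ P.real {ω | -1 < affineRec As Bs n ω ∧ t < As n ω * t * r + Bs n ω} := by
        refine ENNReal.toReal_mono (measure_ne_top _ _) (measure_mono_ae ?_)
        filter_upwards [h.ae_nonneg] with ω hω ⟨hb, hc⟩
        rw [Set.mem_Iic, div_le_iff₀ h0] at hb
        refine ⟨neg_one_lt_zero.trans_le (affineRec_nonneg hω.1 hω.2 n), hc.trans_le ?_⟩
        have := mul_le_mul_of_nonneg_left hb (hω.1 n)
        change As n ω * affineRec As Bs n ω + Bs n ω ≤ _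
        linarith
    _ = P.real {ω | -1 < affineRec As Bs n ω} * P₀.real {ω | t < A ω * t * r + B ω} :=
        h.measureReal_rec_inter n _ _ _
    _ ≤ 1 * Real.exp (-(γ * F t)) := by
        gcongr
        exact measureReal_le_one
    _ = Real.exp (-((γ - μ) * F t)) * (1 * Real.exp (-(μ * F t))) := by
        rw [one_mul, one_mul, ← Real.exp_add]
        ring_nf
    _ ≤ _ := by gcongr

/-- Being above `z t` already costs about `μ z ^ ρ > μ`. -/
lemma tailNegligible_Ioi (hF : RegularlyVarying F ρ) (hFt : Tendsto F atTop atTop) (hρ : 0 < ρ)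
    (hμ : 0 < μ) {z : ℝ} (hz : 1 < z) : TailNegligible P As Bs F μ (Set.Ioi z) := by
  intro κ hκ
  obtain ⟨q, hq1, hq2⟩ := exists_between (Real.one_lt_rpow hz hρ)
  filter_upwards [hF.eventually_ge (one_pos.trans hz) hq2, eventually_gt_atTop 0,
    (tendsto_exp_neg_mul hFt (e := μ * (q - 1))
      (mul_pos hμ (by linarith))).eventually_le_const hκ] with t h2 h0 h3 C hC n hn
  have hC0 : (0 : ℝ) ≤ C := zero_le_one.trans hC
  calc _ ≤ P.real {ω | z * t < affineRec As Bs n ω} :=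
        measureReal_mono fun ω hω => (lt_div_iff₀ h0).1 hω.1
    _ ≤ C * Real.exp (-(μ * F (z * t))) := hn _ (mul_pos (one_pos.trans hz) h0)
    _ ≤ C * Real.exp (-(μ * (q * F t))) := by gcongr
    _ = Real.exp (-((μ * (q - 1)) * F t)) * (C * Real.exp (-(μ * F t))) := by
        rw [mul_left_comm (Real.exp _), ← Real.exp_add]
        ring_nf
    _ ≤ _ := by gcongr

lemma tailNegligible_univ (h : IsIIDCopies P₀ P A B As Bs) (hg : IsLDM P₀ A B f g)
    (hf : ∀ x, 0 < x → 0 < f x) (hFf : Tendsto (fun x => F x / f x) atTop (𝓝 1))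
    (hF : RegularlyVarying F ρ) (hFt : Tendsto F atTop atTop) (hρ : 0 < ρ) (hμ : 0 < μ)
    (hadm : Admissible ρ g) (hpos : 0 < lambdaStar ρ g) (hfin : lambdaStar ρ g < ∞)
    (hμl : μ < (lambdaStar ρ g).toReal) : TailNegligible P As Bs F μ Set.univ := by
  set L := (lambdaStar ρ g).toReal with hL
  have hL0 : 0 < L := hμ.trans hμl
  have hanti := hg.antitone hf (h.nonneg.mono fun _ h => h.1)
  have hcont : ∀ y : ℝ, ContinuousAt (fun x : ℝ => x ^ ρ) y := fun y =>
    Real.continuousAt_rpow_const _ _ (Or.inr hρ.le)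
  obtain ⟨r, hr1, hr⟩ := hadm.exists_one_lt_pos hanti hpos
  obtain ⟨γ, hγ0, hγ⟩ : ∃ γ : ℝ, 0 < γ ∧ ENNReal.ofReal γ < g r := by
    obtain ⟨a, ha1, ha2⟩ := ENNReal.lt_iff_exists_nnreal_btwn.1 hr
    exact ⟨a, by exact_mod_cast ha1, by rwa [ENNReal.ofReal_coe_nnreal]⟩
  obtain ⟨l, hl0, hl1, hl⟩ : ∃ l : ℝ, 0 < l ∧ l < 1 ∧ μ < μ * l ^ ρ + γ := by
    have h1 : Tendsto (fun l : ℝ => μ * l ^ ρ + γ) (𝓝[<] 1) (𝓝 (μ * 1 ^ ρ + γ)) :=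
      ((((hcont 1).tendsto).const_mul μ).add_const γ).mono_left nhdsWithin_le_nhds
    rw [Real.one_rpow, mul_one] at h1
    obtain ⟨l, ha, hb, hc⟩ := ((h1.eventually_const_lt (lt_add_of_pos_right μ hγ0)).and
      ((eventually_nhdsWithin_of_eventually_nhds (eventually_gt_nhds one_pos)).and
        self_mem_nhdsWithin)).exists
    exact ⟨l, hb, hc, ha⟩
  -- A neighbourhood of `1`, where `L * (1 - y ^ ρ)` degenerates and only `g r > 0` helps.
  have hone := tailNegligible_Ioc h hg hf hFf hF hFt hμ hl0 hγ hl
  have hr1' : (1 : ℝ) < r := by exact_mod_cast hr1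
  have hbig : TailNegligible P As Bs F μ (Set.Ioi l) :=
    (hone.union (tailNegligible_Ioi hF hFt hρ hμ hr1')).mono fun x hx => by
      rcases le_or_gt x r with hxr | hxr
      · exact Or.inl ⟨hx, hxr⟩
      · exact Or.inr hxr
  obtain ⟨r₀, hr₀, hzero⟩ : ∃ r₀ : ℝ, 0 < r₀ ∧ TailNegligible P As Bs F μ (Set.Iic r₀) := by
    have h1 : Tendsto (fun x : ℝ => L * (1 - x ^ ρ)) (𝓝[>] 0) (𝓝 (L * (1 - 0 ^ ρ))) :=
      ((((hcont 0).tendsto).const_sub 1).const_mul L).mono_left nhdsWithin_le_nhds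
    rw [Real.zero_rpow hρ.ne', sub_zero, mul_one] at h1
    obtain ⟨x, ha, hb, hc⟩ := ((h1.eventually_const_lt hμl).and
      ((eventually_nhdsWithin_of_eventually_nhds (eventually_lt_nhds one_pos)).and
        self_mem_nhdsWithin)).exists
    obtain ⟨γ, hγ1, hγ2⟩ := exists_between ha
    lift x to ℝ≥0 using le_of_lt hc
    exact ⟨x, hc, tailNegligible_Iic h hg hf hFf hFt
      (ofReal_lt_of_lt_lambdaStar hρ hpos hfin (by exact_mod_cast hc) (by exact_mod_cast hb) hγ2)
      hγ1⟩
  -- On `[r₀, l]` with `l < 1` the gap `(L - μ) * (1 - y ^ ρ)` leaves room for a small interval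
  -- around each point; compactness makes finitely many suffice.
  have hmid : TailNegligible P As Bs F μ (Set.Icc r₀ l) := by
    refine isCompact_Icc.induction_on TailNegligible.empty
      (fun _ _ h1 h2 => h2.mono h1) (fun _ _ h1 h2 => h1.union h2) fun y hy => ?_
    have hy0 : 0 < y := hr₀.trans_le hy.1
    have hy1 : y < 1 := hy.2.trans_lt hl1
    have hyρ : y ^ ρ < 1 := Real.rpow_lt_one hy0.le hy1 hρ
    obtain ⟨γ, hγ1, hγ2⟩ : ∃ γ, μ - μ * y ^ ρ < γ ∧ γ < L * (1 - y ^ ρ) :=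
      exists_between (by nlinarith)
    have h1 : Tendsto (fun x : ℝ => L * (1 - x ^ ρ)) (𝓝[>] y) (𝓝 (L * (1 - y ^ ρ))) :=
      ((((hcont y).tendsto).const_sub 1).const_mul L).mono_left nhdsWithin_le_nhds
    obtain ⟨x, ha, hb, hc⟩ := ((h1.eventually_const_lt hγ2).and
      ((eventually_nhdsWithin_of_eventually_nhds (eventually_lt_nhds hy1)).and
        self_mem_nhdsWithin)).exists
    have h2 : Tendsto (fun l : ℝ => μ * l ^ ρ + γ) (𝓝[<] y) (𝓝 (μ * y ^ ρ + γ)) :=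
      ((((hcont y).tendsto).const_mul μ).add_const γ).mono_left nhdsWithin_le_nhds
    obtain ⟨l', ha', hb', hc'⟩ := ((h2.eventually_const_lt (u := μ) (by linarith)).and
      ((eventually_nhdsWithin_of_eventually_nhds (eventually_gt_nhds hy0)).and
        self_mem_nhdsWithin)).exists
    have hx0 : 0 < x := hy0.trans hc
    lift x to ℝ≥0 using hx0.le
    exact ⟨_, nhdsWithin_le_nhds (Ioc_mem_nhds hc' hc),
      tailNegligible_Ioc h hg hf hFf hF hFt hμ hb'
      (ofReal_lt_of_lt_lambdaStar hρ hpos hfin (by exact_mod_cast hx0) (by exact_mod_cast hb) ha)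
      ha'⟩
  refine ((hzero.union hmid).union hbig).mono fun x _ => ?_
  rcases le_or_gt x r₀ with h1 | h1
  · exact Or.inl (Or.inl h1)
  rcases le_or_gt x l with h2 | h2
  · exact Or.inl (Or.inr ⟨h1.le, h2⟩)
  · exact Or.inr h2

lemma exists_tail_bound (hF : RegularlyVarying F ρ) (hFm : StrictMonoOn F (Set.Ioi 0))
    (hμ : 0 < μ) (h : TailNegligible P As Bs F μ Set.univ) :
    ∃ C : ℝ, ∀ n, ∀ s > 0,
      P.real {ω | s < affineRec As Bs n ω} ≤ C * Real.exp (-(μ * F s)) := by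
  obtain ⟨T, hT⟩ := eventually_atTop.1 (h 1 one_pos)
  set t₀ := max T 1
  have ht0 : 0 < t₀ := one_pos.trans_le (le_max_right _ _)
  have hC1 : 1 ≤ Real.exp (μ * F t₀) := Real.one_le_exp (mul_pos hμ (hF.pos _ ht0)).le
  -- With this constant the bound is trivial for `s < t₀`; above `t₀`, `κ = 1` keeps it unchanged
  -- through the induction.
  refine ⟨Real.exp (μ * F t₀), fun n => ?_⟩
  induction n with
  | zero =>
    intro s hs
    have : {ω | s < affineRec As Bs 0 ω} = ∅ := by
      ext ω; simpa [affineRec] using hs.le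
    rw [this, measureReal_empty]
    positivity
  | succ n ih =>
    intro s hs
    rcases le_or_gt t₀ s with hts | hts
    · simpa using hT s ((le_max_left _ _).trans hts) _ hC1 n ih
    · refine measureReal_le_one.trans ?_
      rw [← Real.exp_add]
      refine Real.one_le_exp ?_
      have := mul_lt_mul_of_pos_left (hFm hs ht0 hts) hμ
      linarith
end

/-! ### Lower tail bound. -/

section
variable {Ω₀ Ω : Type*} [MeasurableSpace Ω₀] [MeasurableSpace Ω] {P₀ : Measure Ω₀}
  {P : Measure Ω} [IsProbabilityMeasure P] [IsProbabilityMeasure P₀]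
  {A B : Ω₀ → ℝ} {As Bs : ℕ → Ω → ℝ} {f F : ℝ → ℝ} {ρ : ℝ} {g : ℝ≥0 → ℝ≥0∞}

/-- The recursion run for `k` steps from `0`, started at any time, exceeds `t` with probability at
least `exp (- η F t)`, for all large `t`. -/
def TailLowerBound (P : Measure Ω) (As Bs : ℕ → Ω → ℝ) (F : ℝ → ℝ) (k : ℕ) (η : ℝ) : Prop :=
  ∀ᶠ t in atTop, ∀ m, Real.exp (-(η * F t)) ≤
    P.real {ω | t < affineRec (fun i => As (m + i)) (fun i => Bs (m + i)) k ω}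

lemma TailLowerBound.succ (h : IsIIDCopies P₀ P A B As Bs) (hg : IsLDM P₀ A B f g)
    (hf : ∀ x, 0 < x → 0 < f x) (hFf : Tendsto (fun x => F x / f x) atTop (𝓝 1))
    (hF : RegularlyVarying F ρ) {y : ℝ≥0} {γ q η : ℝ} (hy : 0 < y) (hγ : g y < ENNReal.ofReal γ)
    (hq : (y : ℝ) ^ ρ < q) (hη : 0 ≤ η) {k : ℕ} (hk : TailLowerBound P As Bs F k η) :
    TailLowerBound P As Bs F (k + 1) (q * η + γ) := by
  have hy' : (0 : ℝ) < y := hy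
  filter_upwards [hg.eventually_ge hf hFf hγ, hF.eventually_le hy' hq, eventually_gt_atTop 0,
    (tendsto_id.const_mul_atTop hy').eventually hk] with t h1 h2 h0 h3 m
  have hm := h.shift m
  calc Real.exp (-((q * η + γ) * F t))
      = Real.exp (-(η * (q * F t))) * Real.exp (-(γ * F t)) := by
        rw [← Real.exp_add]; ring_nf
    _ ≤ Real.exp (-(η * F (y * t))) * Real.exp (-(γ * F t)) := by gcongr
    _ ≤ P.real {ω | y * t < affineRec (fun i => As (m + i)) (fun i => Bs (m + i)) k ω} *
        P₀.real {ω | t < A ω * t * y + B ω} := by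
        gcongr
        exact h3 m
    _ = _ := (hm.measureReal_rec_inter k _ _ _).symm
    _ ≤ _ := by
        refine ENNReal.toReal_mono (measure_ne_top _ _) (measure_mono_ae ?_)
        filter_upwards [h.ae_nonneg] with ω hω ⟨ha, hb⟩
        have := mul_le_mul_of_nonneg_left ha.le (hω.1 (m + k))
        refine lt_of_lt_of_le hb ?_
        change _ ≤ As (m + k) ω * affineRec _ _ k ω + Bs (m + k) ω
        linarith

lemma exists_tailLowerBound_one (h : IsIIDCopies P₀ P A B As Bs) (hA : ∀ᵐ ω ∂P₀, A ω < 1)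
    (hg : IsLDM P₀ A B f g)
    (hf : ∀ x, 0 < x → 0 < f x) (hFf : Tendsto (fun x => F x / f x) atTop (𝓝 1))
    (hF : RegularlyVarying F ρ) {y : ℝ≥0} {γ : ℝ} (hy : y < 1) (hγ0 : 0 < γ)
    (hγ : g y < ENNReal.ofReal γ) :
    ∃ η, 0 ≤ η ∧ TailLowerBound P As Bs F 1 η := by
  have hy' : (0 : ℝ) < 1 - y := sub_pos.2 (by exact_mod_cast hy)
  have hc : (0 : ℝ) < (1 - (y : ℝ))⁻¹ := inv_pos.2 hy'
  -- As `A < 1`, passing `c t` from `c t y` forces `B > c t (1 - y) = t`.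
  set c := (1 - (y : ℝ))⁻¹ with hcdef
  have hcρ : 0 < c ^ ρ := Real.rpow_pos_of_pos hc _
  refine ⟨γ * (c ^ ρ + 1), by positivity, ?_⟩
  filter_upwards [(tendsto_id.const_mul_atTop hc).eventually (hg.eventually_ge hf hFf hγ),
    hF.eventually_le hc (lt_add_one _), eventually_gt_atTop 0] with t h1 h2 h0 m
  have hm := h.shift m
  simp only [id] at h1
  -- With `y = 0` the jump event is `{B > t}`, which is one step from state `0`.
  have key := hm.measureReal_rec_inter 0 (-1) t 0
  have h3 : P.real {ω | -1 < affineRec (fun i => As (m + i)) (fun i => Bs (m + i)) 0 ω} = 1 := by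
    have : {ω | -1 < affineRec (fun i => As (m + i)) (fun i => Bs (m + i)) 0 ω} = Set.univ := by
      ext ω; simp [affineRec]
    rw [this, probReal_univ]
  rw [h3, one_mul] at key
  calc Real.exp (-(γ * (c ^ ρ + 1) * F t)) = Real.exp (-(γ * ((c ^ ρ + 1) * F t))) := by ring_nf
    _ ≤ Real.exp (-(γ * F (c * t))) := by gcongr
    _ ≤ _ := h1
    _ ≤ P₀.real {ω | t < A ω * t * 0 + B ω} := by
        refine ENNReal.toReal_mono (measure_ne_top _ _) (measure_mono_ae ?_)
        filter_upwards [hA] with ω hω hlt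
        change c * t < _ at hlt
        have h4 : A ω * (c * t) * y ≤ 1 * (c * t) * y := by
          have := y.2
          gcongr
        have h5 : (1 - (y : ℝ)) * (c * t) = t := by
          rw [← mul_assoc, hcdef, mul_inv_cancel₀ hy'.ne', one_mul]
        change t < _
        linarith
    _ = _ := key.symm
    _ ≤ _ := by
        refine measureReal_mono fun ω hω => ?_
        have := hω.2
        simpa [affineRec] using this

lemma exists_tailLowerBound (h : IsIIDCopies P₀ P A B As Bs) (hA : ∀ᵐ ω ∂P₀, A ω < 1)
    (hg : IsLDM P₀ A B f g)
    (hf : ∀ x, 0 < x → 0 < f x) (hFf : Tendsto (fun x => F x / f x) atTop (𝓝 1))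
    (hF : RegularlyVarying F ρ) (hρ : 0 < ρ) {ν : ℝ} (hν : lambdaStar ρ g < ENNReal.ofReal ν) :
    ∃ k, 0 < k ∧ TailLowerBound P As Bs F k ν := by
  obtain ⟨y, hy0, hy1, γ, hγ0, hγ, hγν⟩ := exists_lt_of_lambdaStar_lt hρ hν
  have hν0 : 0 < ν := ENNReal.ofReal_pos.1 (lt_of_le_of_lt zero_le hν)
  have hyρ : (y : ℝ) ^ ρ < 1 := Real.rpow_lt_one y.2 (by exact_mod_cast hy1) hρ
  obtain ⟨q, hq1, hq2⟩ : ∃ q, (y : ℝ) ^ ρ < q ∧ q < 1 - γ / ν :=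
    exists_between (by
      have : γ / ν < 1 - (y : ℝ) ^ ρ := by rw [div_lt_iff₀ hν0]; linarith
      linarith)
  have hq0 : 0 < q := (Real.rpow_pos_of_pos (by exact_mod_cast hy0) _).trans hq1
  have hq3 : 0 < 1 - q := by have := div_pos hγ0 hν0; linarith
  obtain ⟨η, hη, h1⟩ := exists_tailLowerBound_one h hA hg hf hFf hF hy1 hγ0 hγ
  -- Fixed point of `η ↦ q * η + γ`.
  set η' := γ / (1 - q) with hη'
  have hη'0 : 0 < η' := div_pos hγ0 hq3
  have hη'ν : η' < ν := by
    rw [hη', div_lt_iff₀ hq3]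
    have : γ / ν < 1 - q := by linarith
    rw [div_lt_iff₀ hν0] at this
    linarith
  have hstep : ∀ k : ℕ, TailLowerBound P As Bs F (k + 1) (η' + q ^ k * η) := by
    intro k
    induction k with
    | zero =>
      filter_upwards [h1, eventually_gt_atTop 0] with t ht h0 m
      refine le_trans (Real.exp_le_exp.2 ?_) (ht m)
      have := mul_pos hη'0 (hF.pos t h0)
      simp only [pow_zero, one_mul]
      linarith
    | succ k ih =>
      have := TailLowerBound.succ h hg hf hFf hF hy0 hγ hq1 (by positivity) ih
      convert this using 1
      have : η' * (1 - q) = γ := div_mul_cancel₀ _ hq3.ne'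
      rw [← this]; ring
  have hlim : Tendsto (fun k : ℕ => η' + q ^ k * η) atTop (𝓝 (η' + 0 * η)) :=
    ((tendsto_pow_atTop_nhds_zero_of_lt_one hq0.le (by linarith)).mul_const η).const_add η'
  obtain ⟨k, hk⟩ := (hlim.eventually_lt_const (u := ν) (by simpa using hη'ν)).exists
  refine ⟨k + 1, k.succ_pos, ?_⟩
  filter_upwards [hstep k, eventually_gt_atTop 0] with t ht h0 m
  refine le_trans (Real.exp_le_exp.2 ?_) (ht m)
  have := mul_lt_mul_of_pos_right hk (hF.pos t h0)
  linarith
end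

/-! ### The inverse function. -/

section
variable {F : ℝ → ℝ}

lemma inverseOnPos_eventually (hFt : Tendsto F atTop atTop) (hFc : ContinuousOn F (Set.Ioi 0)) :
    ∀ᶠ u in atTop, 0 < inverseOnPos F u ∧ F (inverseOnPos F u) = u := by
  filter_upwards [eventually_ge_atTop (F 1)] with u hu
  obtain ⟨T, hT1, hT2⟩ := ((hFt.eventually_ge_atTop u).and (eventually_ge_atTop 1)).exists
  have hsub : Set.Icc 1 T ⊆ Set.Ioi (0 : ℝ) := fun x hx => one_pos.trans_le hx.1
  obtain ⟨x, hx, hxu⟩ := intermediate_value_Icc hT2 (hFc.mono hsub) ⟨hu, hT1⟩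
  have hex : ∃ a ∈ Set.Ioi (0 : ℝ), F a = u := ⟨x, hsub hx, hxu⟩
  exact ⟨Function.invFunOn_mem hex, Function.invFunOn_eq hex⟩

lemma tendsto_inverseOnPos (hFt : Tendsto F atTop atTop) (hFc : ContinuousOn F (Set.Ioi 0))
    (hFm : StrictMonoOn F (Set.Ioi 0)) : Tendsto (inverseOnPos F) atTop atTop := by
  refine Filter.tendsto_atTop.2 fun M => ?_
  have hM : 0 < max M 1 := one_pos.trans_le (le_max_right _ _)
  filter_upwards [inverseOnPos_eventually hFt hFc, eventually_gt_atTop (F (max M 1))]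
    with u ⟨h1, h2⟩ hu
  by_contra! hlt
  have := hFm.monotoneOn h1 hM (hlt.le.trans (le_max_left _ _))
  linarith
end

/-! ### The two Borel–Cantelli arguments. -/

section
variable {Ω₀ Ω : Type*} [MeasurableSpace Ω₀] [MeasurableSpace Ω] {P₀ : Measure Ω₀}
  {P : Measure Ω} [IsProbabilityMeasure P] {A B : Ω₀ → ℝ} {As Bs : ℕ → Ω → ℝ} {F : ℝ → ℝ} {ρ : ℝ}

lemma ae_eventually_le_of_tail_bound (hF : RegularlyVarying F ρ) {b : ℕ → ℝ}
    (hbt : Tendsto b atTop atTop) (hb : ∀ᶠ n in atTop, F (b n) = Real.log n) {μ c C : ℝ}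
    (hμ : 0 < μ) (hc : 0 < c) (hμc : 1 < μ * c ^ ρ)
    (hC : ∀ n, ∀ s > 0, P.real {ω | s < affineRec As Bs n ω} ≤ C * Real.exp (-(μ * F s))) :
    ∀ᵐ ω ∂P, ∀ᶠ n in atTop, affineRec As Bs n ω ≤ c * b n := by
  obtain ⟨q, hq1, hq2⟩ : ∃ q, 1 / μ < q ∧ q < c ^ ρ :=
    exists_between (by rw [div_lt_iff₀ hμ]; linarith)
  rw [div_lt_iff₀ hμ] at hq1
  have hC0 : 0 ≤ C := by
    have := measureReal_nonneg.trans (hC 0 1 one_pos)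
    exact nonneg_of_mul_nonneg_left this (Real.exp_pos _)
  have hsum : Summable (fun n : ℕ => P.real {ω | c * b n < affineRec As Bs n ω}) := by
    -- Since `F (b n) = log n`, the tail bound at `c * b n` is at most `C n ^ (-(q μ))` with `q μ >
    -- 1`.
    have h1 : Summable (fun n : ℕ => C * (n : ℝ) ^ (-(q * μ))) :=
      (Real.summable_nat_rpow.2 (by linarith)).mul_left C
    refine h1.of_norm_bounded_eventually_nat ?_
    filter_upwards [hb, hbt.eventually (hF.eventually_ge hc hq2), hbt.eventually_gt_atTop 0,
      eventually_gt_atTop 0] with n hn1 hn2 hn3 hn4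
    rw [Real.norm_of_nonneg measureReal_nonneg]
    refine (hC n _ (mul_pos hc hn3)).trans (mul_le_mul_of_nonneg_left ?_ hC0)
    rw [Real.rpow_def_of_pos (by exact_mod_cast hn4)]
    refine Real.exp_le_exp.2 ?_
    rw [hn1] at hn2
    have := mul_le_mul_of_nonneg_left hn2 hμ.le
    linarith
  have hne : ∑' n : ℕ, P {ω | c * b n < affineRec As Bs n ω} ≠ ∞ := by
    have := hsum.tsum_ofReal_ne_top
    simpa only [measureReal_def, ENNReal.ofReal_toReal (measure_ne_top _ _)] using this
  filter_upwards [ae_eventually_notMem hne] with ω hω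
  filter_upwards [hω] with n hn
  exact not_lt.1 hn

lemma ae_frequently_gt_of_tailLowerBound (h : IsIIDCopies P₀ P A B As Bs)
    (hF : RegularlyVarying F ρ) {b : ℕ → ℝ}
    (hbt : Tendsto b atTop atTop) (hb : ∀ᶠ n in atTop, F (b n) = Real.log n) {ν c : ℝ} {k : ℕ}
    (hν : 0 < ν) (hc : 0 < c) (hνc : ν * c ^ ρ < 1) (hk0 : 0 < k)
    (hk : TailLowerBound P As Bs F k ν) :
    ∀ᵐ ω ∂P, ∃ᶠ n in atTop, c * b n < affineRec As Bs n ω := by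
  obtain ⟨q, hq1, hq2⟩ : ∃ q, c ^ ρ < q ∧ q < 1 / ν :=
    exists_between (by rw [lt_div_iff₀ hν]; linarith)
  rw [lt_div_iff₀ hν] at hq2
  have hm : Tendsto (fun j : ℕ => j * k + k) atTop atTop :=
    tendsto_atTop_mono (fun j => (Nat.le_mul_of_pos_right j hk0).trans (Nat.le_add_right _ _))
      tendsto_id
  set E : ℕ → Set Ω := fun j => {ω | c * b (j * k + k) <
    affineRec (fun i => As (j * k + i)) (fun i => Bs (j * k + i)) k ω} with hE
  -- Block `j` ends at time `k (j + 1)`, so `exp (-log)` of that time is a harmonic term.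
  have hlow : ∀ᶠ j : ℕ in atTop, (k : ℝ)⁻¹ * ((j + 1 : ℕ) : ℝ)⁻¹ ≤ P.real (E j) := by
    filter_upwards [hm.eventually hb, (hbt.comp hm).eventually (hF.eventually_le hc hq1),
      ((hbt.comp hm).const_mul_atTop hc).eventually hk] with j h1 h2 h3
    refine le_trans ?_ (h3 (j * k))
    simp only [Function.comp] at h2 ⊢
    rw [h1] at h2
    have hpos : (0 : ℝ) < ((j * k + k : ℕ) : ℝ) := by exact_mod_cast Nat.add_pos_right _ hk0
    have hlog : 0 ≤ Real.log ((j * k + k : ℕ) : ℝ) := Real.log_natCast_nonneg _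
    have h4 : (k : ℝ)⁻¹ * ((j + 1 : ℕ) : ℝ)⁻¹ =
        Real.exp (-Real.log ((j * k + k : ℕ) : ℝ)) := by
      rw [Real.exp_neg, Real.exp_log hpos, ← mul_inv]
      push_cast
      ring_nf
    rw [h4]
    refine Real.exp_le_exp.2 (neg_le_neg ?_)
    calc ν * F (c * b (j * k + k)) ≤ ν * (q * Real.log ((j * k + k : ℕ) : ℝ)) := by gcongr
      _ = (q * ν) * Real.log ((j * k + k : ℕ) : ℝ) := by ring
      _ ≤ 1 * Real.log ((j * k + k : ℕ) : ℝ) := by gcongr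
      _ = _ := one_mul _
  have hdiv : ∑' j, P (E j) = ∞ := by
    by_contra hne
    have hs : Summable (fun j => P.real (E j)) := ENNReal.summable_toReal hne
    have hs' : Summable (fun j : ℕ => (k : ℝ)⁻¹ * ((j + 1 : ℕ) : ℝ)⁻¹) := by
      refine hs.of_norm_bounded_eventually_nat ?_
      filter_upwards [hlow] with j hj
      rwa [Real.norm_of_nonneg (by positivity)]
    rw [summable_mul_left_iff (by positivity)] at hs'
    exact Real.not_summable_natCast_inv
      ((summable_nat_add_iff (f := fun n : ℕ => (n : ℝ)⁻¹) 1).1 hs')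
  have hlim := measure_limsup_eq_one (fun j => measurableSet_lt measurable_const
    ((h.shift (j * k)).measurable_rec k)) (h.iIndepSet_blocks k fun j => c * b (j * k + k)) hdiv
  have hae : ∀ᵐ ω ∂P, ω ∈ limsup E atTop := by
    refine (mem_ae_iff_prob_eq_one ?_).2 hlim
    exact MeasurableSet.measurableSet_limsup fun j => measurableSet_lt measurable_const
      ((h.shift (j * k)).measurable_rec k)
  filter_upwards [hae, h.ae_nonneg] with ω hω hpos
  rw [mem_limsup_iff_frequently_mem] at hω
  refine hm.frequently (hω.mono fun j hj => ?_)
  exact lt_of_lt_of_le hj (affineRec_shift_le hpos.1 hpos.2 (j * k) k)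
end

/-! ### Conclusion. -/

lemma one_lt_mul_rpow_of_lt {L c ρ : ℝ} (hL : 0 < L) (hρ : 0 < ρ)
    (h : L ^ (-1 / ρ) < c) : 1 < L * c ^ ρ := by
  have h1 := Real.rpow_lt_rpow (Real.rpow_nonneg hL.le _) h hρ
  rw [← Real.rpow_mul hL.le, div_mul_cancel₀ _ hρ.ne', Real.rpow_neg_one] at h1
  have := mul_lt_mul_of_pos_left h1 hL
  rwa [mul_inv_cancel₀ hL.ne'] at this

lemma mul_rpow_lt_one_of_lt {L c ρ : ℝ} (hL : 0 < L) (hρ : 0 < ρ) (hc : 0 ≤ c)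
    (h : c < L ^ (-1 / ρ)) : L * c ^ ρ < 1 := by
  have h1 := Real.rpow_lt_rpow hc h hρ
  rw [← Real.rpow_mul hL.le, div_mul_cancel₀ _ hρ.ne', Real.rpow_neg_one] at h1
  have := mul_lt_mul_of_pos_left h1 hL
  rwa [mul_inv_cancel₀ hL.ne'] at this

lemma limsup_div_eq_of_forall {x b : ℕ → ℝ} {a : ℝ} {u v : ℕ → ℝ} (hb : ∀ᶠ n in atTop, 0 < b n)
    (hu : Tendsto u atTop (𝓝 a)) (hv : Tendsto v atTop (𝓝 a))
    (hux : ∀ m, ∀ᶠ n in atTop, x n ≤ u m * b n) (hvx : ∀ m, ∃ᶠ n in atTop, v m * b n < x n) :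
    limsup (fun n => ((x n / b n : ℝ) : EReal)) atTop = (a : EReal) := by
  refine le_antisymm ?_ ?_
  · refine ge_of_tendsto ((continuous_coe_real_ereal.tendsto a).comp hu)
      (Eventually.of_forall fun m => limsup_le_of_le (h := ?_))
    filter_upwards [hux m, hb] with n h1 h2
    exact EReal.coe_le_coe_iff.2 ((div_le_iff₀ h2).2 h1)
  · refine le_of_tendsto ((continuous_coe_real_ereal.tendsto a).comp hv)
      (Eventually.of_forall fun m => le_limsup_of_frequently_le' ?_)
    exact ((hvx m).and_eventually hb).mono fun n h =>
      EReal.coe_le_coe_iff.2 ((lt_div_iff₀ h.2).2 h.1).le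

theorem theorem7p1
    {Ω₀ : Type*} [MeasurableSpace Ω₀] (P₀ : Measure Ω₀) [IsProbabilityMeasure P₀]
    {Ω : Type*} [MeasurableSpace Ω] (P : Measure Ω) [IsProbabilityMeasure P]
    -- the generic pair `(A, B)`
    (A B : Ω₀ → ℝ) (hAm : Measurable A) (hBm : Measurable B)
    (hA : ∀ᵐ ω ∂P₀, 0 ≤ A ω ∧ A ω < 1) (hB : ∀ᵐ ω ∂P₀, 0 ≤ B ω)
    (hA0 : P₀ {ω | 0 < A ω} ≠ 0) (hB0 : P₀ {ω | 0 < B ω} ≠ 0)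
    (hlogB : Integrable (fun ω => max (Real.log (B ω)) 0) P₀)
    -- the i.i.d. copies of `(A, B)`
    (As Bs : ℕ → Ω → ℝ) (hAsm : ∀ n, Measurable (As n)) (hBsm : ∀ n, Measurable (Bs n))
    (hindep : iIndepFun (fun n ω => (As n ω, Bs n ω)) P)
    (hident : ∀ n, IdentDistrib (fun ω => (As n ω, Bs n ω)) (fun ω => (A ω, B ω)) P P₀)
    -- the regularly varying function `f` and a continuous, strictly increasing version `f'` of it
    (ρ : ℝ) (hρ : 0 < ρ) (f : ℝ → ℝ) (hf : RegularlyVarying f ρ)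
    (f' : ℝ → ℝ) (hf' : RegularlyVarying f' ρ) (hf'c : ContinuousOn f' (Set.Ioi 0))
    (hf'mono : StrictMonoOn f' (Set.Ioi 0))
    (hff' : Tendsto (fun x => f' x / f x) atTop (𝓝 1))
    -- the local dependence measure
    (g : ℝ≥0 → ℝ≥0∞) (hg : IsLDM P₀ A B f g) (hadm : Admissible ρ g)
    (hpos : 0 < lambdaStar ρ g) (hfin : lambdaStar ρ g < ∞) :
    ∀ᵐ ω ∂P,
      limsup (fun n : ℕ =>
          ((affineRec As Bs n ω / inverseOnPos f' (Real.log (n : ℝ)) : ℝ) : EReal)) atTop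
        = (((lambdaStar ρ g).toReal ^ (-1 / ρ) : ℝ) : EReal) := by
  have h : IsIIDCopies P₀ P A B As Bs :=
    ⟨hAsm, hBsm, hindep, hident, by filter_upwards [hA, hB] with ω h1 h2 using ⟨h1.1, h2⟩⟩
  set L := (lambdaStar ρ g).toReal with hL
  have hL0 : 0 < L := ENNReal.toReal_pos hpos.ne' hfin.ne
  have hFt := hf'.tendsto_atTop hρ hf'mono
  have hlog : Tendsto (fun n : ℕ => Real.log (n : ℝ)) atTop atTop :=
    Real.tendsto_log_atTop.comp tendsto_natCast_atTop_atTop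
  have hbt := (tendsto_inverseOnPos hFt hf'c hf'mono).comp hlog
  have hb := (hlog.eventually (inverseOnPos_eventually hFt hf'c)).mono fun n hn => hn.2
  set a := L ^ (-1 / ρ) with ha
  have ha0 : 0 < a := Real.rpow_pos_of_pos hL0 _
  -- Sequences rather than all constants around `a` keep the exceptional null sets countable in
  -- number.
  obtain ⟨u, -, hu, hua⟩ := exists_seq_strictAnti_tendsto a
  obtain ⟨v, -, hv, hva⟩ := exists_seq_strictMono_tendsto' ha0
  have hupper : ∀ m, ∀ᵐ ω ∂P, ∀ᶠ n : ℕ in atTop,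
      affineRec As Bs n ω ≤ u m * inverseOnPos f' (Real.log (n : ℝ)) := by
    intro m
    have hum := ha0.trans (hu m)
    have hc := Real.rpow_pos_of_pos hum ρ
    obtain ⟨μ, hμ1, hμ2⟩ : ∃ μ, 1 / u m ^ ρ < μ ∧ μ < L :=
      exists_between ((div_lt_iff₀ hc).2 (one_lt_mul_rpow_of_lt hL0 hρ (hu m)))
    have hμ0 : 0 < μ := (one_div_pos.2 hc).trans hμ1
    obtain ⟨C, hC⟩ := exists_tail_bound hf' hf'mono hμ0
      (tailNegligible_univ h hg hf.pos hff' hf' hFt hρ hμ0 hadm hpos hfin hμ2)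
    exact ae_eventually_le_of_tail_bound hf' hbt hb hμ0 hum ((div_lt_iff₀ hc).1 hμ1) hC
  have hlower : ∀ m, ∀ᵐ ω ∂P, ∃ᶠ n : ℕ in atTop,
      v m * inverseOnPos f' (Real.log (n : ℝ)) < affineRec As Bs n ω := by
    intro m
    have hc := Real.rpow_pos_of_pos (hv m).1 ρ
    obtain ⟨ν, hν1, hν2⟩ : ∃ ν, L < ν ∧ ν < 1 / v m ^ ρ :=
      exists_between ((lt_div_iff₀ hc).2 (mul_rpow_lt_one_of_lt hL0 hρ (hv m).1.le (hv m).2))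
    obtain ⟨k, hk0, hk⟩ := exists_tailLowerBound h (hA.mono fun _ h => h.2) hg hf.pos hff' hf' hρ
      (ν := ν) ((ENNReal.lt_ofReal_iff_toReal_lt hfin.ne).2 hν1)
    exact ae_frequently_gt_of_tailLowerBound h hf' hbt hb (hL0.trans hν1) (hv m).1
      ((lt_div_iff₀ hc).1 hν2) hk0 hk
  filter_upwards [ae_all_iff.2 hupper, ae_all_iff.2 hlower] with ω h1 h2
  exact limsup_div_eq_of_forall (hbt.eventually_gt_atTop 0) hua hva h1 h2
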